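/- **Theorem 5.5.** Let $P$ be a poset with no infinite antichain and let $\alpha$ be a countable ordinal. Then the following five properties are equivalent: (i) $P$ is $\alpha$-bqo; (ii) $(P;\le_{\rm succ})$ is $\alpha$-bqo; (iii) $(P;\le_{\rm pred})$ is $\alpha$-bqo; (iv) $(P;\le_{\rm crit})$ is $\alpha$-bqo; (v) the set $AM(P)$ of maximal antichains of $P$, ordered by domination ($A\le B$ iff for every $x\in A$ there is $y\in B$ with $x\le y$), is $\alpha$-bqo. Here $a\le_{\rm pred}b$ means that $x<a$ implies $x<b$ for every $x\in P$; $a\le_{\rm succ}b$ means that $b<y$ implies $a<y$ for every $y\in P$; and $a\le_{\rm crit}b$ means that both $a\le_{\rm pred}b$ and $a\le_{\rm succ}b$. Finite subsets of $\mathbb N$ are identified with their increasing enumerations. A *barrier* is an infinite set $B$ of finite subsets of $\mathbb N$, pairwise incomparable under inclusion, such that every infinite $X\subseteq\bigcup B$ has a nonempty initial segment belonging to $B$; every barrier is well ordered by the lexicographic order, and its *order type* is the type of this well-order. For finite $s,t\subseteq\mathbb N$ write $s\triangleleft t$ if there is a finite $r\subseteq\mathbb N$ such that $s$ is a proper initial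 segment of $r$ and $t$ is $r$ with its least element removed. A quasi-ordered set $(Q;\le)$ is *$\alpha$-bqo* ($\alpha$-better-quasi-ordered) if for every barrier $B$ of order type at most $\alpha$ and every map $f:B\to Q$ there are $s,t\in B$ with $s\triangleleft t$ and $f(s)\le f(t)$. -/

import Mathlib

open scoped Ordinal

/-- `s ≤_in X`: the finite set `s`, listed increasingly, is an initial segment of the
(finite or infinite) set `X ⊆ ℕ`, listed increasingly. -/
def InitSeg (s : Finset ℕ) (X : Set ℕ) : Prop :=
  (s : Set ℕ) ⊆ X ∧ ∀ a ∈ s, ∀ b ∈ X, b < a → b ∈ s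

/-- The domain of a family of finite subsets of `ℕ`: the union of its members. -/
def familyUnion (B : Set (Finset ℕ)) : Set ℕ :=
  {n | ∃ s ∈ B, n ∈ s}

/-- A block: an infinite family `B` of finite subsets of `ℕ` such that every infinite subset of
the union of `B` has a nonempty initial segment in `B`. -/
def IsBlock (B : Set (Finset ℕ)) : Prop :=
  B.Infinite ∧
    ∀ X : Set ℕ, X ⊆ familyUnion B → X.Infinite → ∃ s ∈ B, s.Nonempty ∧ InitSeg s X

/-- A barrier: a block whose members are pairwise incomparable under inclusion. -/
def IsBarrier (B : Set (Finset ℕ)) : Prop :=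
  IsBlock B ∧ IsAntichain (· ⊆ ·) B

/-- `*r`: the set `r` with its least element deleted (and `*∅ = ∅`). -/
def deleteMin (r : Finset ℕ) : Finset ℕ :=
  r.filter fun x => ∃ y ∈ r, y < x

/-- `s ◁ t`: there is a finite `r ⊆ ℕ` such that `s` is a proper initial segment of `r` and
`t = *r`. -/
def Triangle (s t : Finset ℕ) : Prop :=
  ∃ r : Finset ℕ, InitSeg s r ∧ s ≠ r ∧ t = deleteMin r

/-- The strict lexicographic order on the members of a family of finite subsets of `ℕ`, each
identified with the increasing list of its elements. -/
def LexLT (B : Set (Finset ℕ)) (s t : B) : Prop :=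
  (s : Finset ℕ).sort (· ≤ ·) < (t : Finset ℕ).sort (· ≤ ·)

/-- The family `B`, ordered lexicographically, has order type at most `α`.  (Barriers are always
well ordered lexicographically, so that for them the first component is no restriction.) -/
def LexTypeLE (B : Set (Finset ℕ)) (α : Ordinal.{0}) : Prop :=
  ∃ _ : IsWellOrder B (LexLT B), Ordinal.type (LexLT B) ≤ α

/-- The map `f` from `B` to the quasi-ordered set `(Q, r)` is good. -/
def IsGood {Q : Type*} (r : Q → Q → Prop) {B : Set (Finset ℕ)} (f : B → Q) : Prop :=
  ∃ s t : B, Triangle s t ∧ r (f s) (f t)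

/-- The quasi-ordered set `(Q, r)` is `α`-better-quasi-ordered: every map from a barrier of order
type at most `α` to `Q` is good. -/
def IsAlphaBqo (α : Ordinal.{0}) {Q : Type*} (r : Q → Q → Prop) : Prop :=
  ∀ B : Set (Finset ℕ), IsBarrier B → LexTypeLE B α → ∀ f : B → Q, IsGood r f

/-- `a ≤_pred b`: every element strictly below `a` is strictly below `b`. -/
def PredLE {P : Type*} [PartialOrder P] (a b : P) : Prop :=
  ∀ x : P, x < a → x < b

/-- `a ≤_succ b`: every element strictly above `b` is strictly above `a`. -/
def SuccLE {P : Type*} [PartialOrder P] (a b : P) : Prop :=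
  ∀ y : P, b < y → a < y

/-- `a ≤_crit b`: both `a ≤_pred b` and `a ≤_succ b`. -/
def CritLE {P : Type*} [PartialOrder P] (a b : P) : Prop :=
  PredLE a b ∧ SuccLE a b

/-- `AM(P)`: the set of maximal antichains of `P`. -/
def MaxAntichains (P : Type*) [PartialOrder P] : Type _ :=
  {A : Set P // IsMaxAntichain (· ≤ ·) A}

/-- The domination order on the maximal antichains of `P`. -/
def DomLE {P : Type*} [PartialOrder P] (A B : MaxAntichains P) : Prop :=
  ∀ x ∈ A.1, ∃ y ∈ B.1, x ≤ y

/-!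
Suppose `f` is a bad map from a barrier to `(P; ≤)`, where `P` is well founded, hence wqo. On a
smaller barrier `f` has a companion `g` such that `f s < g s` for all `s`, while `f s ≰ g t`
whenever `s ◁ t`. Then `f` is bad for `≤_succ` and `g` is bad for `≤_pred`, so that each of these
orders being `α`-bqo makes `P` `α`-bqo.

To find `g`, fix a nonprincipal ultrafilter on `ℕ` and pass to a set that diagonalizes over it.
The value `f s` is then decided by a shortest initial segment `d` of `s`. As `d` is shortest, this
value depends on the last element of `d`, and as `P` is wqo, it strictly increases with it.
Increasing that element gives `g s`.

For `(i) → (v)`, let `f` be bad for domination. Whenever `s ◁ t`, some `x ∈ f s` lies below no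
element of `f t`. Since `f s` is finite, the ultrafilter selects one `x` that works for generic
`t`, and diagonalizing makes this selection a bad map into `P`. For `(v) → (iii)`, send `a` to the
least maximal antichain containing `a`, which consists of the minimal elements of the complement of
`{x | x < a}`.
-/

open Filter

namespace InitSeg

variable {s t : Finset ℕ} {X : Set ℕ}

lemma refl (s : Finset ℕ) : InitSeg s s :=
  ⟨subset_rfl, fun _ _ _ hb _ => hb⟩

lemma subset (h : InitSeg s t) : s ⊆ t :=
  Finset.coe_subset.1 h.1

lemma trans (hst : InitSeg s t) (htX : InitSeg t X) : InitSeg s X :=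
  ⟨hst.1.trans htX.1, fun a ha b hb hba => hst.2 a ha b (htX.2 a (hst.1 ha) b hb hba) hba⟩

lemma of_subset_of_subset {Y : Set ℕ} (h : InitSeg s X) (hsY : ↑s ⊆ Y) (hYX : Y ⊆ X) :
    InitSeg s Y :=
  ⟨hsY, fun a ha b hb => h.2 a ha b (hYX hb)⟩

lemma total (hs : InitSeg s X) (ht : InitSeg t X) : InitSeg s t ∨ InitSeg t s := by
  suffices s ⊆ t ∨ t ⊆ s from
    this.imp (hs.of_subset_of_subset · ht.1) (ht.of_subset_of_subset · hs.1)
  by_contra! h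
  obtain ⟨a, ha, hat⟩ := Finset.not_subset.1 h.1
  obtain ⟨b, hb, hbs⟩ := Finset.not_subset.1 h.2
  rcases lt_trichotomy a b with hab | rfl | hab
  · exact hat (ht.2 b hb a (hs.1 ha) hab)
  · exact hat hb
  · exact hbs (hs.2 a ha b (ht.1 hb) hab)

lemma lt_of_notMem (h : InitSeg s X) {a b : ℕ} (ha : a ∈ s) (hb : b ∈ X) (hbs : b ∉ s) :
    a < b :=
  lt_of_not_ge fun hba => hba.eq_or_lt.elim (fun e => hbs (e ▸ ha)) (hbs <| h.2 a ha b hb ·)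

lemma union (h : ∀ a ∈ s, ∀ b ∈ X, a < b) : InitSeg s (↑s ∪ X) :=
  ⟨Set.subset_union_left, fun a ha b hb hba =>
    hb.resolve_right fun hbX => (h a ha b hbX).not_gt hba⟩

lemma insert_max {n : ℕ} (h : ∀ a ∈ s, a < n) : InitSeg s (insert n s : Finset ℕ) := by
  simpa using union (X := {n}) (by simpa using h)

lemma insert_min {a : ℕ} (h : InitSeg s X) (ha : ∀ x ∈ X, a < x) :
    InitSeg (insert a s) (insert a X) := by
  refine ⟨by simpa using Set.insert_subset_insert h.1, fun x hx b hb hbx => ?_⟩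
  rcases hb with rfl | hb
  · exact Finset.mem_insert_self _ _
  rcases Finset.mem_insert.1 hx with rfl | hx
  · exact absurd hbx (ha b hb).not_gt
  · exact Finset.mem_insert_of_mem (h.2 x hx b hb hbx)

lemma deleteMin (h : InitSeg s t) : InitSeg (deleteMin s) (deleteMin t) := by
  simp only [InitSeg, _root_.deleteMin, Finset.coe_filter, Finset.mem_filter]
  refine ⟨fun x ⟨hx, y, hy, hyx⟩ => ⟨h.1 hx, y, h.1 hy, hyx⟩, ?_⟩
  rintro a ⟨ha, -⟩ b ⟨hb, c, hc, hcb⟩ hba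
  exact ⟨h.2 a ha b hb hba, c, h.2 a ha c hc (hcb.trans hba), hcb⟩

end InitSeg

lemma deleteMin_insert {a : ℕ} {s : Finset ℕ} (h : ∀ x ∈ s, a < x) :
    deleteMin (insert a s) = s := by
  ext x
  simp only [deleteMin, Finset.mem_filter, Finset.mem_insert]
  constructor
  · rintro ⟨rfl | hx, y, rfl | hy, hyx⟩
    · exact absurd hyx (lt_irrefl _)
    · exact absurd hyx (h y hy).not_gt
    all_goals exact hx
  · exact fun hx => ⟨Or.inr hx, a, Or.inl rfl, h x hx⟩

lemma exists_insert_deleteMin {s : Finset ℕ} (hs : s.Nonempty) :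
    ∃ a, (∀ x ∈ deleteMin s, a < x) ∧ insert a (deleteMin s) = s := by
  have hlt : ∀ x ∈ s.erase (s.min' hs), s.min' hs < x := fun x => s.min'_lt_of_mem_erase_min' hs
  have hdel := deleteMin_insert hlt
  rw [Finset.insert_erase (s.min'_mem hs)] at hdel
  exact ⟨s.min' hs, hdel ▸ hlt, by rw [hdel, Finset.insert_erase (s.min'_mem hs)]⟩

lemma triangle_iff {s t : Finset ℕ} (hs : s.Nonempty) :
    Triangle s t ↔
      ∃ a ∈ s, (∀ x ∈ t, a < x) ∧ InitSeg s (insert a t : Finset ℕ) ∧ s ≠ insert a t := by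
  constructor
  · rintro ⟨r, hsr, hne, rfl⟩
    obtain ⟨a, hlt, har⟩ := exists_insert_deleteMin (hs.mono hsr.subset)
    refine ⟨a, ?_, hlt, har.symm ▸ hsr, har.symm ▸ hne⟩
    obtain ⟨c, hc⟩ := hs
    by_contra ha
    have hca : c < a := hsr.lt_of_notMem hc (har ▸ Finset.mem_insert_self a _) ha
    rcases Finset.mem_insert.1 (har.symm ▸ hsr.subset hc) with rfl | hc'
    · exact ha hc
    · exact (hlt c hc').not_gt hca
  · rintro ⟨a, -, hlt, hst, hne⟩
    exact ⟨insert a t, hst, hne, (deleteMin_insert hlt).symm⟩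

lemma Triangle.initSeg_deleteMin {s t : Finset ℕ} (h : Triangle s t) :
    InitSeg (deleteMin s) t := by
  obtain ⟨r, hsr, -, rfl⟩ := h
  exact hsr.deleteMin

lemma Triangle.lt_of_notMem_deleteMin {s t : Finset ℕ} (h : Triangle s t) {a b : ℕ} (ha : a ∈ s)
    (hb : b ∈ t) (hbs : b ∉ deleteMin s) : a < b := by
  obtain ⟨r, hsr, -, rfl⟩ := h
  obtain ⟨hbr, c, hc, hcb⟩ := Finset.mem_filter.1 hb
  refine hsr.lt_of_notMem ha hbr fun hb => hbs (Finset.mem_filter.2 ⟨hb, c, ?_, hcb⟩)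
  exact hsr.2 b hb c hc hcb

lemma triangle_of_isAntichain {B : Set (Finset ℕ)} (hB : IsAntichain (· ⊆ ·) B) {s t : Finset ℕ}
    (hs : s ∈ B) (ht : t ∈ B) {a : ℕ} {X : Set ℕ} (ha : ∀ x ∈ X, a < x)
    (hsX : InitSeg s (insert a X)) (htX : InitSeg t X) : Triangle s t := by
  have hat : ∀ x ∈ t, a < x := fun x hx => ha x (htX.1 hx)
  have hnot : ¬ insert a t ⊆ s := by
    intro h
    obtain rfl := hB.eq ht hs ((Finset.subset_insert a t).trans h)
    exact lt_irrefl a (hat a (h (Finset.mem_insert_self a t)))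
  refine ⟨insert a t, ?_, fun h => hnot h.ge, (deleteMin_insert hat).symm⟩
  have hatX : InitSeg (insert a t) (insert a X) := htX.insert_min ha
  exact (hsX.total hatX).resolve_right fun h => hnot h.subset

lemma Triangle.insert_of_lt {D : Set (Finset ℕ)} (hD : IsAntichain (· ⊆ ·) D) {c v : Finset ℕ}
    {m n : ℕ} (hc0 : c.Nonempty) (hc : c ∈ D) (hmv : insert m v ∈ D) (hnv : insert n v ∈ D)
    (hvm : ∀ a ∈ v, a < m) (hmn : m < n) (h : Triangle c (insert m v)) :
    Triangle c (insert n v) := by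
  obtain ⟨a, hac, ha, hcm, -⟩ := (triangle_iff hc0).1 h
  obtain ⟨ham, hav⟩ := (Finset.forall_mem_insert _ _ _).1 ha
  have hmc : m ∉ c := by
    intro hmc
    have hsub : insert m v ⊆ c := Finset.insert_subset hmc fun x hx =>
      hcm.2 m hmc x (by simp [hx]) (hvm x hx)
    exact lt_irrefl a (ha a (hD.eq hmv hc hsub ▸ hac))
  have hcv : InitSeg c (insert a v : Finset ℕ) := by
    refine hcm.of_subset_of_subset ?_ (by gcongr; exact Finset.subset_insert m v)
    rw [Finset.coe_subset, ← Finset.subset_insert_iff_of_notMem hmc, Finset.insert_comm]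
    exact hcm.subset
  have han : ∀ x ∈ insert n v, a < x := (Finset.forall_mem_insert _ _ _).2 ⟨ham.trans hmn, hav⟩
  have hvn : InitSeg v (insert n v : Finset ℕ) :=
    .insert_max fun x hx => (hvm x hx).trans hmn
  refine triangle_of_isAntichain hD hc hnv han (hcv.trans ?_) (.refl _)
  simpa using hvn.insert_min han

lemma Triangle.of_initSeg {D : Set (Finset ℕ)} (hD : IsAntichain (· ⊆ ·) D) {s t c d : Finset ℕ}
    (hs : s.Nonempty) (hst : Triangle s t) (hc : c ∈ D) (hcs : InitSeg c s) (hd : d ∈ D)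
    (hdt : InitSeg d t) : Triangle c d := by
  obtain ⟨a, -, hat, hsat, -⟩ := (triangle_iff hs).1 hst
  exact triangle_of_isAntichain hD hc hd hat (by simpa using hcs.trans hsat) hdt

/-- `D` bars `Y`: every infinite subset of `Y` has an initial segment in `D`. A block is an
infinite family that bars its union by nonempty sets. -/
def Bars (D : Set (Finset ℕ)) (Y : Set ℕ) : Prop :=
  ∀ X ⊆ Y, X.Infinite → ∃ s ∈ D, InitSeg s X

/-- The subfamily of the members of `B` contained in `Y`. -/
def restrictFamily (B : Set (Finset ℕ)) (Y : Set ℕ) : Set (Finset ℕ) :=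
  {s ∈ B | (s : Set ℕ) ⊆ Y}

lemma infinite_sep_gt {Y : Set ℕ} (hY : Y.Infinite) (n : ℕ) : {x ∈ Y | n < x}.Infinite :=
  (hY.sdiff (Set.finite_Iic n)).mono fun _ hx => ⟨hx.1, lt_of_not_ge hx.2⟩

lemma exists_infinite_extension {s : Finset ℕ} {Y : Set ℕ} (hs : ↑s ⊆ Y) (hY : Y.Infinite) :
    ∃ X ⊆ Y, X.Infinite ∧ InitSeg s X := by
  refine ⟨↑s ∪ {x ∈ Y | s.sup id < x}, Set.union_subset hs (Set.sep_subset _ _),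
    (infinite_sep_gt hY _).mono Set.subset_union_right, .union fun a ha b hb => ?_⟩
  exact (Finset.le_sup (f := id) ha).trans_lt hb.2

namespace IsBarrier

variable {B : Set (Finset ℕ)} {s : Finset ℕ} {Y : Set ℕ}

lemma bars (hB : IsBarrier B) : Bars B (familyUnion B) := fun X hX hXi =>
  let ⟨s, hs, _, hsX⟩ := hB.1.2 X hX hXi
  ⟨s, hs, hsX⟩

lemma nonempty_of_mem (hB : IsBarrier B) (hs : s ∈ B) : s.Nonempty := by
  rw [Finset.nonempty_iff_ne_empty]
  rintro rfl
  refine hB.1.1 ((Set.finite_singleton (∅ : Finset ℕ)).subset fun t ht => ?_)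
  exact (hB.2.eq hs ht (Finset.empty_subset t)).symm

lemma infinite_familyUnion (hB : IsBarrier B) : (familyUnion B).Infinite := fun h =>
  hB.1.1 <| h.toFinset.powerset.finite_toSet.subset fun s hs =>
    Finset.mem_powerset.2 fun _ hn => h.mem_toFinset.2 ⟨s, hs, hn⟩

lemma restrict (hB : IsBarrier B) (hYB : Y ⊆ familyUnion B) (hY : Y.Infinite) :
    IsBarrier (restrictFamily B Y) := by
  have hbar : ∀ X ⊆ Y, X.Infinite → ∃ s ∈ restrictFamily B Y, s.Nonempty ∧ InitSeg s X :=
    fun X hX hXi =>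
      let ⟨s, hs, hne, hsX⟩ := hB.1.2 X (hX.trans hYB) hXi
      ⟨s, ⟨hs, hsX.1.trans hX⟩, hne, hsX⟩
  refine ⟨⟨fun hfin => ?_, fun X hX => hbar X (hX.trans fun n ⟨s, hs, hn⟩ => hs.2 hn)⟩,
    hB.2.subset fun s hs => hs.1⟩
  have hUnion : (⋃ s ∈ restrictFamily B Y, (s : Set ℕ)).Finite :=
    hfin.biUnion fun s _ => s.finite_toSet
  obtain ⟨s, hs, ⟨n, hn⟩, hsX⟩ := hbar _ Set.sdiff_subset (hY.sdiff hUnion)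
  exact (hsX.1 hn).2 (Set.mem_biUnion hs hn)

lemma exists_triangle (hB : IsBarrier B) (hYB : Y ⊆ familyUnion B) (hY : Y.Infinite) :
    ∃ s ∈ restrictFamily B Y, ∃ t ∈ restrictFamily B Y, Triangle s t := by
  obtain ⟨a, ha⟩ := hY.nonempty
  have hX := infinite_sep_gt hY a
  have hXY : {x ∈ Y | a < x} ⊆ Y := Set.sep_subset _ _
  have haX : insert a {x ∈ Y | a < x} ⊆ Y := Set.insert_subset ha hXY
  obtain ⟨t, ht, htX⟩ := hB.bars _ (hXY.trans hYB) hX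
  obtain ⟨s, hs, hsX⟩ := hB.bars _ (haX.trans hYB) (hX.mono (Set.subset_insert _ _))
  exact ⟨s, ⟨hs, hsX.1.trans haX⟩, t, ⟨ht, htX.1.trans hXY⟩,
    triangle_of_isAntichain hB.2 hs ht (fun _ hx => hx.2) hsX htX⟩

end IsBarrier

lemma LexTypeLE.mono {B B' : Set (Finset ℕ)} {α : Ordinal.{0}} (hB : LexTypeLE B α)
    (h : B' ⊆ B) : LexTypeLE B' α := by
  obtain ⟨_, hle⟩ := hB
  let e : LexLT B' ↪r LexLT B := ⟨Set.embeddingOfSubset B' B h, Iff.rfl⟩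
  have : IsWellOrder B' (LexLT B') := e.isWellOrder
  exact ⟨this, (Ordinal.type_le_iff'.2 ⟨e⟩).trans hle⟩

/-- The map `f` is bad on `B`. Maps are total, so that restricting to a subfamily of `B` does not
change `f`. -/
def IsBad {Q : Type*} (r : Q → Q → Prop) (B : Set (Finset ℕ)) (f : Finset ℕ → Q) : Prop :=
  ∀ s ∈ B, ∀ t ∈ B, Triangle s t → ¬ r (f s) (f t)

section AlphaBqo

variable {Q : Type*} {r r' : Q → Q → Prop} {α : Ordinal.{0}} {B : Set (Finset ℕ)}

lemma isAlphaBqo_iff_not_isBad :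
    IsAlphaBqo α r ↔
      ∀ B, IsBarrier B → LexTypeLE B α → ∀ f : Finset ℕ → Q, ¬ IsBad r B f := by
  refine ⟨fun h B hB hα f hf => ?_, fun h B hB hα f => ?_⟩
  · obtain ⟨s, t, hst, hr⟩ := h B hB hα fun s => f s
    exact hf s s.2 t t.2 hst hr
  · by_contra hf
    obtain ⟨s₀, hs₀⟩ := hB.1.1.nonempty
    refine h B hB hα (Function.extend Subtype.val f fun _ => f ⟨s₀, hs₀⟩) ?_
    intro s hs t ht hst hr
    have hext (u : B) := Subtype.val_injective.extend_apply f (fun _ => f ⟨s₀, hs₀⟩) u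
    rw [hext ⟨s, hs⟩, hext ⟨t, ht⟩] at hr
    exact hf ⟨⟨s, hs⟩, ⟨t, ht⟩, hst, hr⟩

namespace IsAlphaBqo

lemma mono (h : IsAlphaBqo α r) (hr : ∀ a b, r a b → r' a b) : IsAlphaBqo α r' :=
  fun B hB hα f =>
    let ⟨s, t, hst, hrst⟩ := h B hB hα f
    ⟨s, t, hst, hr _ _ hrst⟩

lemma not_isBad_restrict (h : IsAlphaBqo α r) (hB : IsBarrier B) (hα : LexTypeLE B α) {Y : Set ℕ}
    (hYB : Y ⊆ familyUnion B) (hY : Y.Infinite) (f : Finset ℕ → Q) :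
    ¬ IsBad r (restrictFamily B Y) f :=
  isAlphaBqo_iff_not_isBad.1 h _ (hB.restrict hYB hY) (hα.mono (Set.sep_subset _ _)) f

/-- Without a barrier of type at most `α`, that is for `α < ω`, `IsAlphaBqo α r` is vacuous. -/
lemma wellQuasiOrdered (h : IsAlphaBqo α r) (hB : IsBarrier B) (hα : LexTypeLE B α) :
    WellQuasiOrdered r := by
  intro p
  by_contra! hp
  refine isAlphaBqo_iff_not_isBad.1 h B hB hα (fun s => p (sInf (s : Set ℕ))) ?_
  intro s hs t ht hst
  obtain ⟨a, ha, hat, -⟩ := (triangle_iff (hB.nonempty_of_mem hs)).1 hst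
  exact hp _ _ ((Nat.sInf_le ha).trans_lt (hat _ (Nat.sInf_mem (hB.nonempty_of_mem ht))))

end IsAlphaBqo

end AlphaBqo

section Ultrafilter

variable {U : Ultrafilter ℕ} {E : Set ℕ}

lemma exists_ultrafilter_le_cofinite {ι : Type*} {E : Set ι} (hE : E.Infinite) :
    ∃ U : Ultrafilter ι, (U : Filter ι) ≤ cofinite ∧ E ∈ U := by
  have : NeBot (cofinite ⊓ 𝓟 E) := hE.cofinite_inf_principal_neBot
  have h := Ultrafilter.of_le (cofinite ⊓ 𝓟 E)
  exact ⟨Ultrafilter.of _, h.trans inf_le_left, h.trans inf_le_right (mem_principal_self E)⟩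

lemma eventually_forall_mem_lt (hU : (U : Filter ℕ) ≤ cofinite) (w : Finset ℕ) :
    ∀ᶠ n in U, ∀ a ∈ w, a < n :=
  (eventually_all_finset w).2 fun a _ =>
    hU (by rw [Nat.cofinite_eq_atTop]; exact eventually_gt_atTop a)

/-- `Y` is a diagonal intersection of the sets `{n | A w n}`: each of its elements `n` satisfies
`A w n` for all finite sets `w` of smaller elements of `Y`. -/
def Diagonalizes (Y : Set ℕ) (A : Finset ℕ → ℕ → Prop) : Prop :=
  ∀ w : Finset ℕ, ↑w ⊆ Y → ∀ n ∈ Y, (∀ a ∈ w, a < n) → A w n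

lemma exists_diagonalizes (hU : (U : Filter ℕ) ≤ cofinite) (hE : E ∈ U)
    {A : Finset ℕ → ℕ → Prop} (hA : ∀ w, ∀ᶠ n in U, A w n) :
    ∃ Y ⊆ E, Y.Infinite ∧ Diagonalizes Y A := by
  have hnext : ∀ w : Finset ℕ, ∃ n ∈ E, (∀ a ∈ w, a < n) ∧ ∀ v ∈ w.powerset, A v n := fun w =>
    (Eventually.and hE ((eventually_forall_mem_lt hU w).and
      ((eventually_all_finset _).2 fun v _ => hA v))).exists
  choose next hnextE hnext_gt hnextA using hnext
  let S : ℕ → Finset ℕ := Nat.rec ∅ fun _ w => insert (next w) w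
  have next_mem (k : ℕ) : next (S k) ∈ S (k + 1) := Finset.mem_insert_self _ _
  have hS : Monotone S := monotone_nat_of_le_succ fun k => Finset.subset_insert _ _
  have hmono : StrictMono fun k => next (S k) :=
    strictMono_nat_of_lt_succ fun k => hnext_gt _ _ (next_mem k)
  refine ⟨Set.range fun k => next (S k), ?_, Set.infinite_range_of_injective hmono.injective, ?_⟩
  · rintro _ ⟨k, rfl⟩
    exact hnextE _
  · rintro w hw _ ⟨k, rfl⟩ hlt
    refine hnextA _ w (Finset.mem_powerset.2 fun a ha => ?_)
    obtain ⟨j, rfl⟩ := hw ha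
    exact hS (Nat.succ_le_of_lt (hmono.lt_iff_lt.1 (hlt _ ha))) (next_mem j)

lemma exists_diagonalizes₂ (hU : (U : Filter ℕ) ≤ cofinite) (hE : E ∈ U)
    {A : Finset ℕ → ℕ → ℕ → Prop} (hA : ∀ w, ∀ᶠ m in U, ∀ᶠ n in U, A w m n) :
    ∃ Y ⊆ E, Y.Infinite ∧
      Diagonalizes Y fun w m => ∀ n ∈ Y, m < n → A w m n := by
  -- The second clause passes what holds for `U`-almost all `n` on to every later element of `Y`.
  have hreflect : ∀ w, ∀ᶠ k in U, (∀ᶠ n in U, A w k n) ∧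
      ∀ v ∈ w.powerset, ∀ m ∈ w, (∀ᶠ n in U, A v m n) → A v m k := fun w =>
    (hA w).and <| (eventually_all_finset _).2 fun v _ => (eventually_all_finset _).2 fun m _ =>
      eventually_imp_distrib_left.2 id
  obtain ⟨Y, hYE, hY, hdiag⟩ := exists_diagonalizes hU hE hreflect
  refine ⟨Y, hYE, hY, fun w hw m hm hwm n hn hmn => ?_⟩
  refine (hdiag (insert m w) ?_ n hn ?_).2 w ?_ m (Finset.mem_insert_self m w)
    (hdiag w hw m hm hwm).1
  · simpa using Set.insert_subset hm hw
  · exact Finset.forall_mem_insert _ _ _ |>.2 ⟨hmn, fun a ha => (hwm a ha).trans hmn⟩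
  · exact Finset.mem_powerset.2 (Finset.subset_insert m w)

lemma eventually_eventually_of_wellQuasiOrdered {ι Q : Type*} {r : Q → Q → Prop}
    (hr : WellQuasiOrdered r) (U : Ultrafilter ι) (p : ι → Q) :
    ∀ᶠ i in U, ∀ᶠ j in U, r (p i) (p j) := by
  by_contra h
  have hbad : ∀ᶠ i in U, ∀ᶠ j in U, ¬ r (p i) (p j) := by
    simpa only [← Ultrafilter.eventually_not] using h
  obtain ⟨g, -, hg⟩ := exists_seq_of_forall_finset_exists (fun i => ∀ᶠ j in U, ¬ r (p i) (p j))
    (fun i j => ¬ r (p i) (p j))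
    fun s hs => (hbad.and ((eventually_all_finset s).2 hs)).exists
  obtain ⟨m, n, hmn, hle⟩ := hr (p ∘ g)
  exact hg m n hmn hle

/-- `Generic U Q v`: by repeatedly inserting `U`-almost any number into `v`, one is sure to reach
a member of `Q` after finitely many steps. -/
inductive Generic (U : Ultrafilter ℕ) (Q : Set (Finset ℕ)) : Finset ℕ → Prop
  | of_mem {v : Finset ℕ} : v ∈ Q → Generic U Q v
  | of_forall_insert {v : Finset ℕ} (A : Set ℕ) : A ∈ U → (∀ n ∈ A, Generic U Q (insert n v)) →
      Generic U Q v

namespace Generic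

variable {Q : Set (Finset ℕ)} {v : Finset ℕ}

lemma of_eventually (h : ∀ᶠ n in U, Generic U Q (insert n v)) : Generic U Q v :=
  .of_forall_insert _ h fun _ hn => hn

lemma eventually (h : Generic U Q v) (hv : v ∉ Q) : ∀ᶠ n in U, Generic U Q (insert n v) := by
  cases h with
  | of_mem h => exact absurd h hv
  | of_forall_insert A hA h => exact mem_of_superset hA h

lemma exists_initSeg (hU : (U : Filter ℕ) ≤ cofinite) (h : Generic U Q v) :
    ∃ t ∈ Q, InitSeg v t := by
  induction h with
  | of_mem h => exact ⟨_, h, .refl _⟩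
  | @of_forall_insert v A hA _ ih =>
    obtain ⟨n, hn, hlt⟩ := (Eventually.and hA (eventually_forall_mem_lt hU v)).exists
    obtain ⟨t, ht, hvt⟩ := ih n hn
    exact ⟨t, ht, (InitSeg.insert_max hlt).trans hvt⟩

lemma exists_mem_of_finite {ι : Type*} {F : Set ι} (hF : F.Finite) {C : ι → Set (Finset ℕ)}
    (hQ : ∀ t ∈ Q, ∃ i ∈ F, t ∈ C i) (h : Generic U Q v) : ∃ i ∈ F, Generic U (C i) v := by
  induction h with
  | of_mem h =>
    obtain ⟨i, hi, ht⟩ := hQ _ h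
    exact ⟨i, hi, .of_mem ht⟩
  | @of_forall_insert v A hA _ ih =>
    have hcover : (⋃ i ∈ F, {n | Generic U (C i) (insert n v)}) ∈ U :=
      mem_of_superset hA fun n hn => by simpa using ih n hn
    obtain ⟨i, hi, hev⟩ := (Ultrafilter.finite_biUnion_mem_iff hF).1 hcover
    exact ⟨i, hi, of_eventually hev⟩

lemma of_forall_infinite (hU : (U : Filter ℕ) ≤ cofinite) (hE : E ∈ U)
    (h : ∀ Y ⊆ E, Y.Infinite → ∃ w : Finset ℕ, ↑w ⊆ Y ∧ v ∪ w ∈ Q) : Generic U Q v := by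
  by_contra hv
  have hstep : ∀ w, ∀ᶠ n in U, ¬ Generic U Q (v ∪ w) → ¬ Generic U Q (insert n (v ∪ w)) :=
    fun w => eventually_imp_distrib_left.2 fun hw =>
      Ultrafilter.eventually_not.2 (mt of_eventually hw)
  obtain ⟨Y, hYE, hY, hdiag⟩ := exists_diagonalizes hU hE hstep
  have hnot : ∀ w : Finset ℕ, ↑w ⊆ Y → ¬ Generic U Q (v ∪ w) := by
    intro w
    induction w using Finset.induction_on_max with
    | empty => intro _; simpa using hv
    | insert n w hn ih =>
      intro hw
      rw [Finset.coe_insert, Set.insert_subset_iff] at hw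
      rw [Finset.union_insert]
      exact hdiag w hw.2 n hw.1 hn (ih hw.2)
  obtain ⟨w, hw, hQ⟩ := h Y hYE hY
  exact hnot w hw (.of_mem hQ)

end Generic

/-- Adding `n` keeps every subset of `w` generic for those of the families `𝒬 u`, `u ⊆ w`, for
which it was generic. Indexing by finite sets lets one diagonalize over countably many families. -/
def PreservesGeneric (U : Ultrafilter ℕ) (𝒬 : Finset ℕ → Set (Finset ℕ)) (w : Finset ℕ) (n : ℕ) :
    Prop :=
  ∀ u ∈ w.powerset, ∀ v ∈ w.powerset, v ∉ 𝒬 u → Generic U (𝒬 u) v → Generic U (𝒬 u) (insert n v)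

variable {𝒬 : Finset ℕ → Set (Finset ℕ)}

lemma eventually_preservesGeneric (w : Finset ℕ) : ∀ᶠ n in U, PreservesGeneric U 𝒬 w n :=
  (eventually_all_finset _).2 fun _ _ => (eventually_all_finset _).2 fun _ _ =>
    eventually_imp_distrib_left.2 fun hv => eventually_imp_distrib_left.2 fun h => h.eventually hv

lemma Generic.exists_initSeg_or_initSeg (hU : (U : Filter ℕ) ≤ cofinite) {Y : Set ℕ}
    (hY : Diagonalizes Y (PreservesGeneric U 𝒬)) {u v t : Finset ℕ} (hu : ↑u ⊆ Y) (ht : ↑t ⊆ Y)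
    (hvt : InitSeg v t) (hut : ∀ a ∈ u, ∀ b ∈ t, b ∉ v → a < b) (h : Generic U (𝒬 u) v) :
    ∃ c ∈ 𝒬 u, InitSeg c t ∨ InitSeg t c := by
  by_cases! hno : ∃ c ∈ 𝒬 u, InitSeg c t
  · exact hno.imp fun c hc => ⟨hc.1, .inl hc.2⟩
  suffices key : ∀ w : Finset ℕ, InitSeg (v ∪ w) t → Disjoint v w → Generic U (𝒬 u) (v ∪ w) by
    have ht : Generic U (𝒬 u) t := by
      have := key (t \ v)
      rw [Finset.union_sdiff_of_subset hvt.subset] at this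
      exact this (.refl t) Finset.disjoint_sdiff
    exact (ht.exists_initSeg hU).imp fun c hc => ⟨hc.1, .inr hc.2⟩
  intro w
  induction w using Finset.induction_on_max with
  | empty => simpa using fun _ => h
  | insert n w hn ih =>
    intro hw hdisj
    rw [Finset.disjoint_insert_right] at hdisj
    rw [Finset.union_insert] at hw ⊢
    have hnt : n ∈ t := hw.subset (Finset.mem_insert_self _ _)
    have hlt : ∀ a ∈ v ∪ w, a < n := fun a ha =>
      (Finset.mem_union.1 ha).elim (fun ha => hvt.lt_of_notMem ha hnt hdisj.1) (hn a)
    have hvw : InitSeg (v ∪ w) t := (InitSeg.insert_max hlt).trans hw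
    refine hY (u ∪ (v ∪ w)) ?_ n (ht hnt) ?_ u ?_ _ ?_ (fun h => hno _ h hvw) (ih hvw hdisj.2)
    · rw [Finset.coe_union]
      exact Set.union_subset hu (hvw.1.trans ht)
    · exact fun a ha => (Finset.mem_union.1 ha).elim (fun ha => hut a ha n hnt hdisj.1) (hlt a)
    · exact Finset.mem_powerset.2 Finset.subset_union_left
    · exact Finset.mem_powerset.2 Finset.subset_union_right

lemma Generic.mem_of_isAntichain (hU : (U : Filter ℕ) ≤ cofinite) {B : Set (Finset ℕ)}
    (hB : IsAntichain (· ⊆ ·) B) (h𝒬 : ∀ u, 𝒬 u ⊆ B) {Y : Set ℕ}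
    (hY : Diagonalizes Y (PreservesGeneric U 𝒬)) {u v t : Finset ℕ} (hu : ↑u ⊆ Y)
    (ht : t ∈ restrictFamily B Y) (hvt : InitSeg v t) (hut : ∀ a ∈ u, ∀ b ∈ t, b ∉ v → a < b)
    (h : Generic U (𝒬 u) v) : t ∈ 𝒬 u := by
  obtain ⟨c, hc, hct | htc⟩ := h.exists_initSeg_or_initSeg hU hY hu ht.2 hvt hut
  · exact hB.eq (h𝒬 u hc) ht.1 hct.subset ▸ hc
  · exact (hB.eq ht.1 (h𝒬 u hc) htc.subset).symm ▸ hc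

/-- Nash-Williams: every block contains a barrier. -/
lemma Bars.exists_bars_minimal {D : Set (Finset ℕ)} {Y : Set ℕ} (hD : Bars D Y)
    (hY : Y.Infinite) : ∃ Z ⊆ Y, Z.Infinite ∧ Bars {d | Minimal (· ∈ D) d} Z := by
  set M : Set (Finset ℕ) := {d | Minimal (· ∈ D) d}
  obtain ⟨U, hU, hYU⟩ := exists_ultrafilter_le_cofinite hY
  have hgen : Generic U M ∅ := by
    refine .of_forall_infinite hU hYU fun X hXY hX => ?_
    obtain ⟨s, hs, hsX⟩ := hD X hXY hX
    obtain ⟨d, hds, hd⟩ := exists_minimal_le_of_wellFoundedLT (· ∈ D) s hs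
    exact ⟨d, (Finset.coe_subset.2 hds).trans hsX.1, by rwa [Finset.empty_union]⟩
  obtain ⟨Z, hZY, hZ, hdiag⟩ := exists_diagonalizes hU hYU
    (eventually_preservesGeneric (𝒬 := fun _ => M))
  refine ⟨Z, hZY, hZ, fun X hXZ hX => ?_⟩
  obtain ⟨s, hs, hsX⟩ := hD X (hXZ.trans hZY) hX
  obtain ⟨d, hd, hds | hsd⟩ := hgen.exists_initSeg_or_initSeg hU hdiag (u := ∅) (by simp)
    (hsX.1.trans hXZ) ⟨by simp, by simp⟩ (by simp)
  · exact ⟨d, hd, hds.trans hsX⟩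
  · exact ⟨s, hd.eq_of_le hs hsd.subset ▸ hd, hsX⟩

end Ultrafilter

section FiniteDomination

lemma generic_deleteMin {U : Ultrafilter ℕ} (hU : (U : Filter ℕ) ≤ cofinite)
    {B : Set (Finset ℕ)} (hB : IsBarrier B) (hE : familyUnion B ∈ U) {s : Finset ℕ} (hs : s ∈ B) :
    Generic U {t ∈ B | Triangle s t} (deleteMin s) := by
  refine .of_forall_infinite hU (Eventually.and hE (eventually_forall_mem_lt hU s))
    fun Y hYE hY => ?_
  obtain ⟨a, ha, has⟩ := exists_insert_deleteMin (hB.nonempty_of_mem hs)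
  have hsub : ∀ x ∈ deleteMin s, x ∈ s := fun x hx => has ▸ Finset.mem_insert_of_mem hx
  have hasY : a ∈ s := has ▸ Finset.mem_insert_self a _
  have hsX : InitSeg (deleteMin s) (↑(deleteMin s) ∪ Y) :=
    .union fun x hx n hn => (hYE hn).2 x (hsub x hx)
  have haX : ∀ x ∈ ↑(deleteMin s) ∪ Y, a < x := fun x hx =>
    hx.elim (ha x) fun hx => (hYE hx).2 a hasY
  have hXB : ↑(deleteMin s) ∪ Y ⊆ familyUnion B :=
    Set.union_subset (fun x hx => ⟨s, hs, hsub x hx⟩) fun x hx => (hYE hx).1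
  obtain ⟨t, ht, htX⟩ := hB.bars _ hXB (hY.mono Set.subset_union_right)
  have hst : Triangle s t :=
    triangle_of_isAntichain hB.2 hs ht haX (by simpa only [has] using hsX.insert_min haX) htX
  refine ⟨t \ deleteMin s, fun x hx => ?_, ?_⟩
  · rw [Finset.mem_coe, Finset.mem_sdiff] at hx
    exact (htX.1 hx.1).resolve_left hx.2
  · rw [Finset.union_sdiff_of_subset hst.initSeg_deleteMin.subset]
    exact ⟨ht, hst⟩

lemma IsAlphaBqo.finite_domination {Q R : Type*} {r : Q → Q → Prop} {α : Ordinal.{0}}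
    (h : IsAlphaBqo α r) {F : R → Set Q} (hF : ∀ A, (F A).Finite) :
    IsAlphaBqo α fun A A' => ∀ x ∈ F A, ∃ y ∈ F A', r x y := by
  refine isAlphaBqo_iff_not_isBad.2 fun B hB hα f hf => ?_
  obtain ⟨U, hU, hE⟩ := exists_ultrafilter_le_cofinite hB.infinite_familyUnion
  let C (x : Q) : Set (Finset ℕ) := {t ∈ B | ∀ y ∈ F (f t), ¬ r x y}
  have hwitness : ∀ s ∈ B, ∃ x ∈ F (f s), Generic U (C x) (deleteMin s) := fun s hs =>
    (generic_deleteMin hU hB hE hs).exists_mem_of_finite (hF _) fun t ht => by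
      simpa [C, ht.1] using hf s hs t ht.1 ht.2
  have : Nonempty Q := by
    obtain ⟨s, hs⟩ := hB.1.1.nonempty
    exact (hwitness s hs).nonempty
  choose! x hxF hx using hwitness
  obtain ⟨Y, hYB, hY, hdiag⟩ := exists_diagonalizes hU hE
    (eventually_preservesGeneric (𝒬 := fun s => C (x s)))
  refine h.not_isBad_restrict hB hα hYB hY x fun s hs t ht hst => ?_
  have htC : t ∈ C (x s) :=
    (hx s hs.1).mem_of_isAntichain hU hB.2 (fun _ => Set.sep_subset _ _) hdiag hs.2 ht
      hst.initSeg_deleteMin fun a ha b => hst.lt_of_notMem_deleteMin ha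
  exact htC.2 _ (hxF t ht.1)

end FiniteDomination

section Companion

variable {P : Type*} [PartialOrder P] {B D : Set (Finset ℕ)} {f F : Finset ℕ → P} {Y : Set ℕ}

/-- On the members of the barrier `B` inside `Y`, the map `f` factors through the map `F` on the
initial segments that belong to `D`, and `F` is strictly increasing in the last element of its
argument. -/
structure AscendingFactorization (B : Set (Finset ℕ)) (f : Finset ℕ → P) (Y : Set ℕ)
    (D : Set (Finset ℕ)) (F : Finset ℕ → P) : Prop where
  empty_notMem : ∅ ∉ D
  exists_initSeg : ∀ s ∈ restrictFamily B Y, ∃ d ∈ D, InitSeg d s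
  eq_of_initSeg : ∀ d ∈ D, ∀ s ∈ restrictFamily B Y, InitSeg d s → f s = F d
  ascending : ∀ v : Finset ℕ, ↑v ⊆ Y → ∀ m ∈ Y, ∀ n ∈ Y, (∀ a ∈ v, a < m) → m < n → v ∉ D →
    insert m v ∈ D → insert n v ∈ D ∧ F (insert m v) < F (insert n v)

lemma eventually_eventually_lt_of_not_constant (hwqo : WellQuasiOrdered fun a b : P => a ≤ b)
    {U : Ultrafilter ℕ} {v : Finset ℕ}
    (hF : ∀ q, ¬ ∀ᶠ n in U, insert n v ∈ D ∧ F (insert n v) = q) :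
    ∀ᶠ m in U, ∀ᶠ n in U, insert m v ∈ D → insert n v ∈ D ∧ F (insert m v) < F (insert n v) := by
  by_cases hD : ∀ᶠ n in U, insert n v ∈ D
  · filter_upwards [eventually_eventually_of_wellQuasiOrdered hwqo U fun n => F (insert n v)]
      with m hm
    filter_upwards [hm, hD, Ultrafilter.eventually_not.2 (hF (F (insert m v)))]
      with n hle hn hne _
    exact ⟨hn, hle.lt_of_ne fun e => hne ⟨hn, e.symm⟩⟩
  · filter_upwards [Ultrafilter.eventually_not.2 hD] with m hm
    exact .of_forall fun n h => absurd h hm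

lemma exists_ascendingFactorization (hwqo : WellQuasiOrdered fun a b : P => a ≤ b)
    (hB : IsBarrier B) (hf : IsBad (· ≤ ·) B f) :
    ∃ Y ⊆ familyUnion B, Y.Infinite ∧ ∃ D F, AscendingFactorization B f Y D F := by
  obtain ⟨U, hU, hE⟩ := exists_ultrafilter_le_cofinite hB.infinite_familyUnion
  -- `D` consists of the sets `v` that decide `f`: it is constant at the generic `t` above `v`.
  let fiber (p : P) : Set (Finset ℕ) := {s ∈ B | f s = p}
  let D : Set (Finset ℕ) := {v | ∃ p, Generic U (fiber p) v}
  have : Nonempty P := ⟨f ∅⟩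
  choose! F hF using fun v (hv : v ∈ D) => hv
  have hlt : ∀ v, ∀ᶠ m in U, ∀ᶠ n in U, v ∉ D → insert m v ∈ D →
      insert n v ∈ D ∧ F (insert m v) < F (insert n v) := by
    intro v
    by_cases hv : v ∈ D
    · exact .of_forall fun m => .of_forall fun n h => absurd hv h
    refine (eventually_eventually_lt_of_not_constant hwqo fun q hq => hv ⟨q, ?_⟩).mono
      fun m hm => hm.mono fun n hn _ => hn
    exact .of_eventually (hq.mono fun n hn => hn.2 ▸ hF _ hn.1)
  obtain ⟨Y, hYB, hY, hdiag⟩ := exists_diagonalizes₂ hU hE fun w =>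
    (eventually_preservesGeneric (𝒬 := fun v => fiber (F v)) w).and (hlt w) |>.mono
      fun m hm => hm.2.mono fun n hn => And.intro hm.1 hn
  have hpres : Diagonalizes Y (PreservesGeneric U fun v => fiber (F v)) := fun w hw m hm hwm =>
    let ⟨n, hn, hmn⟩ := hY.exists_gt m
    (hdiag w hw m hm hwm n hn hmn).1
  have hval : ∀ d ∈ D, ∀ s ∈ restrictFamily B Y, InitSeg d s → f s = F d := fun d hd s hs hds =>
    ((hF d hd).mem_of_isAntichain hU hB.2 (fun _ => Set.sep_subset _ _) hpres (hds.1.trans hs.2)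
      hs hds fun a ha b hb => hds.lt_of_notMem ha hb).2
  refine ⟨Y, hYB, hY, D, F, fun h0 => ?_, fun s hs => ⟨s, ⟨f s, .of_mem ⟨hs.1, rfl⟩⟩, .refl s⟩,
    hval, fun v hv m hm n hn hvm hmn => (hdiag v hv m hm hvm n hn hmn).2⟩
  obtain ⟨s, hs, t, ht, hst⟩ := hB.exists_triangle hYB hY
  have hconst (u : Finset ℕ) (hu : u ∈ restrictFamily B Y) : f u = F ∅ :=
    hval ∅ h0 u hu ⟨by simp, by simp⟩
  exact hf s hs.1 t ht.1 hst ((hconst s hs).trans (hconst t ht).symm).le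

lemma Bars.minimal_insert {Z : Set ℕ} (hbars : Bars {d | Minimal (· ∈ D) d} Z) (hZ : Z.Infinite)
    {v : Finset ℕ} {m n : ℕ} (hv : ↑v ⊆ Z) (hn : n ∈ Z) (hvm : ∀ a ∈ v, a < m) (hmn : m < n)
    (hmv : Minimal (· ∈ D) (insert m v)) (hnv : insert n v ∈ D) :
    Minimal (· ∈ D) (insert n v) := by
  have hvn : ↑(insert n v : Finset ℕ) ⊆ Z := by simpa using Set.insert_subset hn hv
  obtain ⟨X, hXZ, hX, hvX⟩ := exists_infinite_extension hvn hZ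
  obtain ⟨d, hd, hdX⟩ := hbars X hXZ hX
  have hnd : n ∈ d := by
    by_contra hnd
    have hdvn : d ⊆ insert n v := ((hdX.total hvX).resolve_right fun h =>
      hnd (h.subset (Finset.mem_insert_self n v))).subset
    have hdv : d ⊆ v := (Finset.subset_insert_iff_of_notMem hnd).1 hdvn
    have hmd : insert m v ⊆ d := hmv.le_of_le hd.prop (hdv.trans (Finset.subset_insert m v))
    exact lt_irrefl m (hvm m (hdv (hmd (Finset.mem_insert_self m v))))
  have hvd : insert n v ⊆ d := Finset.insert_subset hnd fun a ha =>
    hdX.2 n hnd a (hvX.1 (Finset.mem_insert_of_mem ha)) ((hvm a ha).trans hmn)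
  exact hd.eq_of_le hnv hvd ▸ hd

namespace AscendingFactorization

lemma nonempty (h : AscendingFactorization B f Y D F) {d : Finset ℕ} (hd : d ∈ D) : d.Nonempty :=
  Finset.nonempty_iff_ne_empty.2 fun e => h.empty_notMem (e ▸ hd)

lemma bars (h : AscendingFactorization B f Y D F) (hB : IsBarrier B) (hYB : Y ⊆ familyUnion B) :
    Bars D Y := fun X hXY hX =>
  let ⟨s, hs, hsX⟩ := hB.bars X (hXY.trans hYB) hX
  let ⟨d, hd, hds⟩ := h.exists_initSeg s ⟨hs, hsX.1.trans hXY⟩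
  ⟨d, hd, hds.trans hsX⟩

lemma exists_minimal (h : AscendingFactorization B f Y D F) (hB : IsBarrier B)
    (hYB : Y ⊆ familyUnion B) (hY : Y.Infinite) :
    ∃ Z ⊆ Y, Z.Infinite ∧ AscendingFactorization B f Z {d | Minimal (· ∈ D) d} F := by
  obtain ⟨Z, hZY, hZ, hbars⟩ := (h.bars hB hYB).exists_bars_minimal hY
  have hsub (s) (hs : s ∈ restrictFamily B Z) : s ∈ restrictFamily B Y := ⟨hs.1, hs.2.trans hZY⟩
  refine ⟨Z, hZY, hZ, fun h0 => h.empty_notMem h0.prop, fun s hs => ?_,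
    fun d hd s hs => h.eq_of_initSeg d hd.prop s (hsub s hs),
    fun v hv m hm n hn hvm hmn _ hmv => ?_⟩
  · obtain ⟨X, hXZ, hX, hsX⟩ := exists_infinite_extension hs.2 hZ
    obtain ⟨d, hd, hdX⟩ := hbars X hXZ hX
    obtain ⟨c, hc, hcs⟩ := h.exists_initSeg s (hsub s hs)
    refine ⟨d, hd, (hdX.total hsX).elim id fun hsd => ?_⟩
    exact hd.eq_of_le hc (hcs.trans hsd).subset ▸ hcs
  · have hvD : v ∉ D := fun hvD =>
      lt_irrefl m (hvm m (hmv.le_of_le hvD (Finset.subset_insert m v) (Finset.mem_insert_self m v)))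
    obtain ⟨hnv, hlt⟩ := h.ascending v (hv.trans hZY) m (hZY hm) n (hZY hn) hvm hmn hvD hmv.prop
    exact ⟨hbars.minimal_insert hZ hv hn hvm hmn hmv hnv, hlt⟩

lemma isBad (h : AscendingFactorization B f Y D F) (hB : IsBarrier B) (hYB : Y ⊆ familyUnion B)
    (hY : Y.Infinite) (hD : IsAntichain (· ⊆ ·) D) (hf : IsBad (· ≤ ·) B f) :
    IsBad (· ≤ ·) (restrictFamily D Y) F := by
  intro c hc d hd hcd hle
  have value_eq : ∀ e ∈ D, ∀ X ⊆ Y, InitSeg e X → ∀ s ∈ B, InitSeg s X → f s = F e := by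
    intro e he X hXY heX s hs hsX
    have hsY : s ∈ restrictFamily B Y := ⟨hs, hsX.1.trans hXY⟩
    obtain ⟨e', he', hes⟩ := h.exists_initSeg s hsY
    have hee' : e' = e := ((hes.trans hsX).total heX).elim (fun hss => hD.eq he' he hss.subset)
      fun hss => (hD.eq he he' hss.subset).symm
    exact hee' ▸ h.eq_of_initSeg e' he' s hsY hes
  obtain ⟨a, ha, had, hcd, -⟩ := (triangle_iff (h.nonempty hc.1)).1 hcd
  obtain ⟨X, hXY, hX, hdX⟩ := exists_infinite_extension (Y := {x ∈ Y | a < x})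
    (fun x hx => ⟨hd.2 hx, had x hx⟩) (infinite_sep_gt hY a)
  have haX : ∀ x ∈ X, a < x := fun x hx => (hXY hx).2
  have hXY' : X ⊆ Y := hXY.trans (Set.sep_subset _ _)
  have haXY : insert a X ⊆ Y := Set.insert_subset (hc.2 ha) hXY'
  obtain ⟨t, ht, htX⟩ := hB.bars X (hXY'.trans hYB) hX
  obtain ⟨s, hs, hsX⟩ := hB.bars _ (haXY.trans hYB) (hX.mono (Set.subset_insert a X))
  refine hf s hs t ht (triangle_of_isAntichain hB.2 hs ht haX hsX htX) ?_
  rwa [value_eq c hc.1 _ haXY (hcd.trans (hdX.insert_min haX)) s hs hsX,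
    value_eq d hd.1 X hXY' hdX t ht htX]

lemma exists_lt (h : AscendingFactorization B f Y D F) (hY : Y.Infinite)
    (hD : IsAntichain (· ⊆ ·) D) {d : Finset ℕ} (hd : d ∈ restrictFamily D Y) :
    ∃ d' ∈ restrictFamily D Y, F d < F d' ∧
      ∀ c ∈ restrictFamily D Y, Triangle c d → Triangle c d' := by
  have hne := h.nonempty hd.1
  obtain ⟨v, m, hvm, rfl⟩ : ∃ v m, (∀ a ∈ v, a < m) ∧ insert m v = d :=
    ⟨d.erase (d.max' hne), d.max' hne, fun a => d.lt_max'_of_mem_erase_max' hne,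
      Finset.insert_erase (d.max'_mem hne)⟩
  have hdY := hd.2
  rw [Finset.coe_insert, Set.insert_subset_iff] at hdY
  obtain ⟨n, hn, hmn⟩ := hY.exists_gt m
  have hvD : v ∉ D := fun hv => lt_irrefl m <| hvm m <|
    hD.eq hv hd.1 (Finset.subset_insert m v) ▸ Finset.mem_insert_self m v
  obtain ⟨hnv, hlt⟩ := h.ascending v hdY.2 m hdY.1 n hn hvm hmn hvD hd.1
  refine ⟨insert n v, ⟨hnv, by simpa using Set.insert_subset hn hdY.2⟩, hlt, fun c hc hcd => ?_⟩
  exact hcd.insert_of_lt hD (h.nonempty hc.1) hc.1 hd.1 hnv hvm hmn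

end AscendingFactorization

lemma exists_companion (hwqo : WellQuasiOrdered fun a b : P => a ≤ b) (hB : IsBarrier B)
    (hf : IsBad (· ≤ ·) B f) :
    ∃ Y ⊆ familyUnion B, Y.Infinite ∧ ∃ g : Finset ℕ → P, (∀ s ∈ restrictFamily B Y, f s < g s) ∧
      ∀ s ∈ restrictFamily B Y, ∀ t ∈ restrictFamily B Y, Triangle s t → ¬ f s ≤ g t := by
  obtain ⟨Y, hYB, hY, D, F, h⟩ := exists_ascendingFactorization hwqo hB hf
  obtain ⟨Z, hZY, hZ, h⟩ := h.exists_minimal hB hYB hY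
  have hZB := hZY.trans hYB
  have hD : IsAntichain (· ⊆ ·) {d | Minimal (· ∈ D) d} := setOfPred_minimal_antichain (· ∈ D)
  choose! front front_mem front_initSeg using h.exists_initSeg
  have front_restrict (s) (hs : s ∈ restrictFamily B Z) :
      front s ∈ restrictFamily {d | Minimal (· ∈ D) d} Z :=
    ⟨front_mem s hs, (front_initSeg s hs).1.trans hs.2⟩
  have f_eq (s) (hs : s ∈ restrictFamily B Z) : f s = F (front s) :=
    h.eq_of_initSeg _ (front_mem s hs) s hs (front_initSeg s hs)
  choose! succ succ_mem lt_succ triangle_succ using fun d => h.exists_lt hZ hD (d := d)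
  refine ⟨Z, hZB, hZ, fun s => F (succ (front s)), fun s hs => ?_, fun s hs t ht hst => ?_⟩
  · exact (f_eq s hs).trans_lt (lt_succ _ (front_restrict s hs))
  · have hfront : Triangle (front s) (front t) := hst.of_initSeg hD (hB.nonempty_of_mem hs.1)
      (front_mem s hs) (front_initSeg s hs) (front_mem t ht) (front_initSeg t ht)
    rw [f_eq s hs]
    exact h.isBad hB hZB hZ hD hf _ (front_restrict s hs) _ (succ_mem _ (front_restrict t ht))
      (triangle_succ _ (front_restrict t ht) _ (front_restrict s hs) hfront)

end Companion

section Order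

lemma wellFoundedLT_of_wellQuasiOrdered {P : Type*} [Preorder P] {r : P → P → Prop}
    (h : WellQuasiOrdered r) (hr : ∀ a b, r a b → ¬ b < a) : WellFoundedLT P := by
  refine ⟨RelEmbedding.wellFounded_iff_isEmpty.2 ⟨fun e => ?_⟩⟩
  obtain ⟨i, j, hij, hle⟩ := h e
  exact hr _ _ hle (e.map_rel_iff.2 hij)

lemma minimal_not_lt_self {P : Type*} [Preorder P] (a : P) : Minimal (fun x => ¬ x < a) a :=
  ⟨lt_irrefl a, fun _ hx hxa => by_contra fun h => hx (lt_of_le_not_ge hxa h)⟩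

variable {P : Type*} [PartialOrder P] {α : Ordinal.{0}}

lemma CritLE.of_le {a b : P} (h : a ≤ b) : CritLE a b :=
  ⟨fun _ hx => hx.trans_le h, fun _ hy => h.trans_lt hy⟩

lemma IsAlphaBqo.le_of_predLE (hP : ∀ A : Set P, IsAntichain (· ≤ ·) A → A.Finite)
    (h : IsAlphaBqo α (PredLE (P := P))) : IsAlphaBqo α (fun a b : P => a ≤ b) := by
  refine isAlphaBqo_iff_not_isBad.2 fun B hB hα f hf => ?_
  have hwf : WellFoundedLT P := wellFoundedLT_of_wellQuasiOrdered (h.wellQuasiOrdered hB hα)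
    fun a b hab hba => lt_irrefl b (hab b hba)
  obtain ⟨Y, hYB, hY, g, hfg, hg⟩ := exists_companion (wellQuasiOrderedLE_iff.2 ⟨hwf, hP⟩).wqo hB hf
  exact h.not_isBad_restrict hB hα hYB hY g
    fun s hs t ht hst hle => hg s hs t ht hst (hle _ (hfg s hs)).le

lemma IsAlphaBqo.le_of_succLE (hP : ∀ A : Set P, IsAntichain (· ≤ ·) A → A.Finite)
    (h : IsAlphaBqo α (SuccLE (P := P))) : IsAlphaBqo α (fun a b : P => a ≤ b) := by
  refine isAlphaBqo_iff_not_isBad.2 fun B hB hα f hf => ?_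
  have hwf : WellFoundedLT P := wellFoundedLT_of_wellQuasiOrdered (h.wellQuasiOrdered hB hα)
    fun a b hab hba => lt_irrefl a (hab a hba)
  obtain ⟨Y, hYB, hY, g, hfg, hg⟩ := exists_companion (wellQuasiOrderedLE_iff.2 ⟨hwf, hP⟩).wqo hB hf
  exact h.not_isBad_restrict hB hα hYB hY f
    fun s hs t ht hst hle => hg s hs t ht hst (hle _ (hfg t ht)).le

lemma exists_mem_maxAntichains (a : P) : ∃ A : MaxAntichains P, a ∈ A.1 := by
  obtain ⟨M, hM, hmax⟩ := zorn_subset_nonempty {A : Set P | IsAntichain (· ≤ ·) A}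
    (fun c hc hchain _ => ⟨⋃₀ c, (Set.pairwise_sUnion hchain.directedOn).2 hc,
      fun s hs => Set.subset_sUnion_of_mem hs⟩) {a} (IsAntichain.singleton)
  exact ⟨⟨M, hmax.prop, fun t ht hMt => hMt.antisymm (hmax.2 ht hMt)⟩, hM rfl⟩

lemma wellFoundedLT_of_wellQuasiOrdered_domLE (h : WellQuasiOrdered (DomLE (P := P))) :
    WellFoundedLT P := by
  choose A hA using exists_mem_maxAntichains (P := P)
  refine wellFoundedLT_of_wellQuasiOrdered (r := fun a b => DomLE (A a) (A b))
    (fun p => h (A ∘ p)) fun a b hab hba => ?_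
  obtain ⟨y, hy, hay⟩ := hab a (hA a)
  have hby : b < y := hba.trans_le hay
  exact (A b).2.1 (hA b) hy hby.ne hby.le

lemma isMaxAntichain_minimal_not_lt [WellFoundedLT P] (a : P) :
    IsMaxAntichain (· ≤ ·) {x : P | Minimal (fun y => ¬ y < a) x} := by
  refine ⟨setOfPred_minimal_antichain _, fun t ht hsub => hsub.antisymm fun z hz => ?_⟩
  have hza : ¬ z < a := fun hza => ht hz (hsub (minimal_not_lt_self a)) hza.ne hza.le
  obtain ⟨y, hyz, hy⟩ := exists_minimal_le_of_wellFoundedLT (fun y => ¬ y < a) z hza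
  exact ht.eq (hsub hy) hz hyz ▸ hy

lemma IsAlphaBqo.predLE_of_domLE (h : IsAlphaBqo α (DomLE (P := P))) :
    IsAlphaBqo α (PredLE (P := P)) := by
  intro B hB hα f
  have := wellFoundedLT_of_wellQuasiOrdered_domLE (h.wellQuasiOrdered hB hα)
  obtain ⟨s, t, hst, hle⟩ := h B hB hα fun s => ⟨_, isMaxAntichain_minimal_not_lt (f s)⟩
  refine ⟨s, t, hst, fun x hx => ?_⟩
  by_contra hxt
  obtain ⟨y, hyx, hy⟩ := exists_minimal_le_of_wellFoundedLT (fun y => ¬ y < f t) x hxt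
  obtain ⟨z, hz, hsz⟩ := hle (f s) (minimal_not_lt_self (f s))
  have hyz : y < z := (hyx.trans_lt hx).trans_le hsz
  exact setOfPred_minimal_antichain (fun y => ¬ y < f t) hy hz hyz.ne hyz.le

end Order

theorem theorem5p5_general {P : Type*} [PartialOrder P]
    (hP : ∀ A : Set P, IsAntichain (· ≤ ·) A → A.Finite) (α : Ordinal.{0}) :
    List.TFAE
      [IsAlphaBqo α (fun a b : P => a ≤ b),
       IsAlphaBqo α (SuccLE (P := P)),
       IsAlphaBqo α (PredLE (P := P)),
       IsAlphaBqo α (CritLE (P := P)),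
       IsAlphaBqo α (DomLE (P := P))] := by
  tfae_have 1 → 4 := fun h => h.mono fun _ _ => CritLE.of_le
  tfae_have 4 → 2 := fun h => h.mono fun _ _ hab => hab.2
  tfae_have 4 → 3 := fun h => h.mono fun _ _ hab => hab.1
  tfae_have 2 → 1 := IsAlphaBqo.le_of_succLE hP
  tfae_have 3 → 1 := IsAlphaBqo.le_of_predLE hP
  tfae_have 1 → 5 := fun h => h.finite_domination fun A : MaxAntichains P => hP A.1 A.2.1
  tfae_have 5 → 3 := IsAlphaBqo.predLE_of_domLE
  tfae_finish

theorem theorem5p5 {P : Type*} [PartialOrder P]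
    (hP : ∀ A : Set P, IsAntichain (· ≤ ·) A → A.Finite)
    (α : Ordinal.{0}) (hα : α < ω₁) :
    List.TFAE
      [IsAlphaBqo α (fun a b : P => a ≤ b),
       IsAlphaBqo α (SuccLE (P := P)),
       IsAlphaBqo α (PredLE (P := P)),
       IsAlphaBqo α (CritLE (P := P)),
       IsAlphaBqo α (DomLE (P := P))] :=
  theorem5p5_general hP α
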